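/- Let $D\subset\mathbb{C}$ be a bounded domain whose boundary $\Gamma=\partial D$ is a Jordan curve of class $C^1$ (i.e. $\Gamma$ has a closed, injective, continuously differentiable parametrization with nowhere vanishing derivative), endowed with the positive (counterclockwise) orientation, and let $z_1\in D$. Suppose that there are real constants $a$ and $b$ such that $$\frac{1}{2\pi i}\int_{\Gamma}\frac{\overline{\xi}}{\xi-z}\,d\xi=\frac{a}{z-z_1}+\frac{b}{(z-z_1)^2}\qquad\text{for all } z\in\mathbb{C}\setminus\overline{D}.$$ Then there exists a real constant $c$ such that $\Gamma$ is contained in the set $$\{z\in\mathbb{C}:\ |z-z_1|^4+a|z-z_1|^2+2b\,\mathrm{Re}\,z=c\}.$$ -/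

import Mathlib

open Complex Set

/-- `γ : ℝ → ℂ` is a `1`-periodic regular `C¹` parametrization of a Jordan curve of class `C¹`:
it is continuously differentiable with nowhere vanishing derivative, and it runs through
every point of its image exactly once in a period. -/
structure IsC1JordanParam (γ : ℝ → ℂ) : Prop where
  contDiff : ContDiff ℝ 1 γ
  periodic : Function.Periodic γ 1
  injOn : InjOn γ (Ico 0 1)
  deriv_ne_zero : ∀ t, deriv γ t ≠ 0

/-- The contour integral of `f` along the closed curve `γ`. -/
noncomputable def contourIntegral (γ : ℝ → ℂ) (f : ℂ → ℂ) : ℂ :=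
  ∫ t in (0 : ℝ)..1, f (γ t) * deriv γ t

/-- The winding number of the closed curve `γ` about the point `z` (off the curve). -/
noncomputable def windingNumber (γ : ℝ → ℂ) (z : ℂ) : ℂ :=
  1 / (2 * Real.pi * I) * contourIntegral γ (fun ξ => 1 / (ξ - z))

/-- `D` is a bounded domain whose boundary is the Jordan curve `Γ`. -/
structure IsEnclosedBy (D Γ : Set ℂ) : Prop where
  isOpen : IsOpen D
  isConnected : IsConnected D
  isBounded : Bornology.IsBounded D
  frontier_eq : frontier D = Γ

/-- `γ` is a positively oriented regular `C¹` parametrization of the Jordan curve `Γ = ∂D`: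
it winds once counterclockwise around the points of `D`. -/
structure IsPositiveC1Param (γ : ℝ → ℂ) (Γ D : Set ℂ) : Prop where
  isC1JordanParam : IsC1JordanParam γ
  range_eq : range γ = Γ
  winding : ∀ z ∈ D, windingNumber γ z = 1

/-- The Cauchy integral of the function `ξ ↦ conj ξ` along `γ`. -/
noncomputable def cauchyIntegralConj (γ : ℝ → ℂ) (z : ℂ) : ℂ :=
  1 / (2 * Real.pi * I) * contourIntegral γ (fun ξ => (starRingEnd ℂ) ξ / (ξ - z))

/-! The integral Ψ(z) of conj(ξ - z)/(ξ - z) over Γ, divided by 2πi, has a bounded kernel and is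
continuous on ℂ. Off Γ it is the Cauchy integral of conj ξ minus conj z times the winding number.
Outside the closure of D it is therefore the given rational function, and by continuity it keeps
this value on Γ. In D the function H = Ψ + conj(z - z₁) is holomorphic. With w = z - z₁, on Γ one
gets H = conj w + a/w + b/w². A polynomial G in w and H cancels the poles and equals |w|⁴ + a|w|² +
2b Re w on Γ. So G is holomorphic in D, continuous up to Γ and real there, hence constant.

The argument needs winding number 0 outside the closure of D, and Γ in the closure of that exterior
(`windingNumber_eq_zero_and_subset_closure`). Both follow without the Jordan curve theorem from the
two connected one-sided collars of Γ (`exists_collars`): D contains one, and the other has winding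
number 0. -/

open Filter Topology Metric

/-! ### Uniform local geometry of a C¹ Jordan curve. -/

namespace IsC1JordanParam

variable {γ : ℝ → ℂ}

lemma continuous_deriv (h : IsC1JordanParam γ) : Continuous (deriv γ) :=
  h.contDiff.continuous_deriv le_rfl

lemma hasDerivAt (h : IsC1JordanParam γ) (t : ℝ) : HasDerivAt γ (deriv γ t) t :=
  (h.contDiff.differentiable one_ne_zero t).hasDerivAt

lemma periodic_deriv (h : IsC1JordanParam γ) : Function.Periodic (deriv γ) 1 := by
  intro t
  rw [← deriv_comp_add_const, funext h.periodic]

lemma uniformContinuous_deriv (h : IsC1JordanParam γ) : UniformContinuous (deriv γ) := by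
  have huc := (isCompact_Icc (a := (-1 : ℝ)) (b := 2)).uniformContinuousOn_of_continuous
    h.continuous_deriv.continuousOn
  refine Metric.uniformContinuous_iff.2 fun c hc => ?_
  obtain ⟨η, hη, H⟩ := Metric.uniformContinuousOn_iff.1 huc c hc
  -- The bound 1 keeps `x` in [-1, 2] once an integer shift has moved `t` into [0, 1).
  refine ⟨min η 1, by positivity, fun {x t} hxt => ?_⟩
  have hf : ∀ u : ℝ, deriv γ (u - ⌊t⌋) = deriv γ u := fun u => by
    simpa only [mul_one] using h.periodic_deriv.sub_int_mul_eq (x := u) ⌊t⌋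
  have h0 : 0 ≤ t - ⌊t⌋ := Int.fract_nonneg t
  have h3 : t - ⌊t⌋ < 1 := Int.fract_lt_one t
  obtain ⟨h4, h5⟩ := lt_min_iff.1 hxt
  rw [Real.dist_eq, abs_lt] at h5
  rw [← hf x, ← hf t]
  refine H _ ⟨by linarith [h5.1], by linarith [h5.2]⟩ _ ⟨by linarith, by linarith⟩ ?_
  rwa [dist_sub_right]

lemma isCompact_range (h : IsC1JordanParam γ) : IsCompact (range γ) :=
  h.periodic.compact_of_continuous one_ne_zero h.contDiff.continuous

lemma exists_norm_deriv_le (h : IsC1JordanParam γ) : ∃ M : ℝ, 0 < M ∧ ∀ t, ‖deriv γ t‖ ≤ M := by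
  obtain ⟨M, hM, hb⟩ :=
    (h.periodic_deriv.compact_of_continuous one_ne_zero h.continuous_deriv).isBounded.exists_pos_norm_le
  exact ⟨M, hM, fun t => hb _ (mem_range_self t)⟩

lemma exists_le_norm_deriv (h : IsC1JordanParam γ) : ∃ m : ℝ, 0 < m ∧ ∀ t, m ≤ ‖deriv γ t‖ := by
  obtain ⟨m, hm, hb⟩ :=
    (h.periodic_deriv.compact_of_continuous one_ne_zero h.continuous_deriv).exists_forall_le'
      (f := fun z => ‖z‖) (a := 0) continuous_norm.continuousOn
      (by rintro _ ⟨t, rfl⟩; exact norm_pos_iff.2 (h.deriv_ne_zero t))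
  exact ⟨m, hm, fun t => hb _ (mem_range_self t)⟩

lemma apply_sub_int (h : IsC1JordanParam γ) (t : ℝ) (n : ℤ) : γ (t - n) = γ t := by
  simpa only [mul_one] using h.periodic.sub_int_mul_eq (x := t) n

lemma exists_int_of_eq (h : IsC1JordanParam γ) {s t : ℝ} (hst : γ s = γ t) :
    ∃ n : ℤ, s - t = n := by
  have hf : ∀ u, γ (Int.fract u) = γ u := fun u => h.apply_sub_int u ⌊u⌋
  have := h.injOn ⟨Int.fract_nonneg s, Int.fract_lt_one s⟩ ⟨Int.fract_nonneg t, Int.fract_lt_one t⟩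
    (by rw [hf, hf, hst])
  exact Int.fract_eq_fract.1 this

lemma exists_norm_sub_sub_le (h : IsC1JordanParam γ) {c : ℝ} (hc : 0 < c) :
    ∃ η > 0, ∀ t s : ℝ, |s - t| < η → ‖γ s - γ t - (s - t) * deriv γ t‖ ≤ c * |s - t| := by
  obtain ⟨η, hη, H⟩ := Metric.uniformContinuous_iff.1 h.uniformContinuous_deriv c hc
  refine ⟨η, hη, fun t s hst => ?_⟩
  have hd : ∀ x ∈ ball t η, HasDerivWithinAt (fun x : ℝ => γ x - (x : ℂ) * deriv γ t)
      (deriv γ x - 1 * deriv γ t) (ball t η) x := fun x _ =>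
    ((h.hasDerivAt x).sub (((hasDerivAt_id x).ofReal_comp).mul_const _)).hasDerivWithinAt
  have := (convex_ball t η).norm_image_sub_le_of_norm_hasDerivWithin_le hd (C := c)
    (fun x hx => by
      rw [one_mul, ← dist_eq_norm]
      exact (H (mem_ball.1 hx)).le) (mem_ball_self hη)
    (by rwa [mem_ball, Real.dist_eq] : s ∈ ball t η)
  rw [Real.norm_eq_abs] at this
  rw [show γ s - γ t - (s - t) * deriv γ t
    = γ s - (s : ℂ) * deriv γ t - (γ t - (t : ℂ) * deriv γ t) by ring]
  exact this

/-- Compactness: an integer parameter difference of size at most 1/2 is 0, so the chord cannot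
vanish on the compact set of pairs kept apart by `η`. -/
lemma exists_le_norm_sub (h : IsC1JordanParam γ) {η : ℝ} (hη : 0 < η) :
    ∃ δ > 0, ∀ t s : ℝ, η ≤ |s - t| → |s - t| ≤ 1 / 2 → δ ≤ ‖γ s - γ t‖ := by
  have hK : IsCompact ((Icc (0 : ℝ) 1 ×ˢ Icc (-1 : ℝ) 2) ∩
      {p : ℝ × ℝ | η ≤ |p.2 - p.1| ∧ |p.2 - p.1| ≤ 1 / 2}) := by
    refine (isCompact_Icc.prod isCompact_Icc).inter_right ?_
    have hc : Continuous fun p : ℝ × ℝ => |p.2 - p.1| := by fun_prop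
    exact (isClosed_le continuous_const hc).inter (isClosed_le hc continuous_const)
  have hγ := h.contDiff.continuous
  obtain ⟨δ, hδ, H⟩ := hK.exists_forall_le' (f := fun p => ‖γ p.2 - γ p.1‖) (a := 0)
    (by fun_prop) (by
      rintro ⟨t, s⟩ ⟨-, h1, h2⟩
      refine norm_pos_iff.2 (sub_ne_zero.2 fun he => ?_)
      obtain ⟨n, hn⟩ := h.exists_int_of_eq he
      simp only [hn] at h1 h2
      have : |n| < 1 := by
        have : ((|n| : ℤ) : ℝ) < 1 := by push_cast; linarith
        exact_mod_cast this
      rw [Int.abs_lt_one_iff.1 this] at h1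
      simp at h1
      linarith)
  refine ⟨δ, hδ, fun t s h1 h2 => ?_⟩
  have e : (s - ⌊t⌋) - (t - ⌊t⌋) = s - t := by ring
  have h0 := Int.fract_nonneg t
  have h3 := Int.fract_lt_one t
  rw [← Int.self_sub_floor] at h0 h3
  have h4 := abs_le.1 h2
  have := H (t - ⌊t⌋, s - ⌊t⌋) ⟨⟨⟨h0, h3.le⟩, ⟨by linarith [h4.1], by linarith [h4.2]⟩⟩, by
    simp only [mem_ofPred_eq, e]; exact ⟨h1, h2⟩⟩
  simpa only [h.apply_sub_int] using this

/-- The normal segments of small uniform length meet the curve only at their foot points. -/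
lemma exists_normal_notMem_range (h : IsC1JordanParam γ) :
    ∃ ε₀ > 0, ∀ t ε : ℝ, ε ≠ 0 → |ε| < ε₀ → γ t + ε * (I * deriv γ t) ∉ range γ := by
  obtain ⟨m, hm, hmb⟩ := h.exists_le_norm_deriv
  obtain ⟨M, hM, hMb⟩ := h.exists_norm_deriv_le
  obtain ⟨η, hη, H1⟩ := h.exists_norm_sub_sub_le (half_pos hm)
  obtain ⟨δ, hδ, H2⟩ := h.exists_le_norm_sub hη
  refine ⟨δ / M, by positivity, fun t ε hε hεδ ⟨s₀, hs₀⟩ => ?_⟩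
  obtain ⟨s, hs, hst⟩ : ∃ s, γ s = γ t + ε * (I * deriv γ t) ∧ |s - t| ≤ 1 / 2 := by
    refine ⟨s₀ - round (s₀ - t), ?_, ?_⟩
    · rw [h.apply_sub_int, hs₀]
    · have := abs_sub_round (s₀ - t)
      rwa [sub_right_comm]
  rcases lt_or_ge |s - t| η with hlt | hge
  -- Near parameters: the error is (-(s - t) + εi) γ'(t), whose modulus is at least m max(|s - t|,
  -- |ε|), too large for the bound (m/2)|s - t|.
  · have h1 := H1 t s hlt
    have h2 : γ s - γ t - (s - t) * deriv γ t = (⟨-(s - t), ε⟩ : ℂ) * deriv γ t := by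
      rw [hs, show (⟨-(s - t), ε⟩ : ℂ) = -(s - t) + ε * I by
        apply Complex.ext <;> simp]
      ring
    rw [h2, norm_mul] at h1
    have h3 : |s - t| ≤ ‖(⟨-(s - t), ε⟩ : ℂ)‖ := by
      simpa [abs_sub_comm] using Complex.abs_re_le_norm ⟨-(s - t), ε⟩
    have h4 : |ε| ≤ ‖(⟨-(s - t), ε⟩ : ℂ)‖ := Complex.abs_im_le_norm ⟨-(s - t), ε⟩
    have h5 := abs_pos.2 hε
    nlinarith [hmb t]
  -- Far parameters: the chord has length at least `δ`, the normal segment less than `δ`.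
  · have h1 := H2 t s hge hst
    rw [hs, add_sub_cancel_left, norm_mul, norm_mul, norm_I, one_mul, norm_real,
      Real.norm_eq_abs] at h1
    rw [lt_div_iff₀ hM] at hεδ
    nlinarith [hMb t, abs_nonneg ε]

/-- A point off the curve but close to it lies on a short normal segment. -/
lemma exists_eq_normal (h : IsC1JordanParam γ) {ε₀ : ℝ} (hε₀ : 0 < ε₀) :
    ∃ δ > 0, ∀ z ∉ range γ, infDist z (range γ) < δ →
      ∃ t ε : ℝ, ε ≠ 0 ∧ |ε| < ε₀ ∧ z = γ t + ε * (I * deriv γ t) := by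
  obtain ⟨m, hm, hmb⟩ := h.exists_le_norm_deriv
  refine ⟨ε₀ * m, by positivity, fun z hz hzd => ?_⟩
  obtain ⟨_, ⟨t, rfl⟩, ht⟩ := h.isCompact_range.exists_infDist_eq_dist (range_nonempty γ) z
  -- At a nearest point of the curve the derivative of the squared distance vanishes, so z - γ(t) is
  -- normal to the curve.
  have hmin : IsLocalMin (fun s => ‖γ s - z‖ ^ 2) t := by
    refine Eventually.of_forall fun s => ?_
    have : dist z (γ t) ≤ dist z (γ s) := ht ▸ infDist_le_dist_of_mem (mem_range_self s)
    rw [dist_comm z, dist_comm z, dist_eq_norm, dist_eq_norm] at this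
    dsimp only
    gcongr
  have hd := ((h.hasDerivAt t).sub_const z).norm_sq
  have hin := hmin.hasDerivAt_eq_zero hd
  have hd0 := h.deriv_ne_zero t
  have hre : ((z - γ t) / deriv γ t).re = 0 := by
    rw [Complex.div_re]
    have : inner ℝ (γ t - z) (deriv γ t) = 0 := by simpa using hin
    rw [Complex.inner] at this
    simp at this
    rw [← add_div, div_eq_zero_iff]
    left
    simp
    linarith
  set ε := ((z - γ t) / deriv γ t).im with hεdef
  have hεe : (z - γ t) / deriv γ t = ε * I := by
    apply Complex.ext <;> simp [hre, hεdef]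
  have hzε : z - γ t = ε * (I * deriv γ t) := by
    rw [div_eq_iff hd0] at hεe
    rw [hεe]; ring
  refine ⟨t, ε, fun h0 => hz ⟨t, ?_⟩, ?_, by rw [← hzε]; ring⟩
  · rw [h0] at hzε
    simp at hzε
    exact (sub_eq_zero.1 hzε).symm
  · rw [ht, dist_eq_norm, hzε, norm_mul, norm_mul, norm_I, one_mul, norm_real,
      Real.norm_eq_abs] at hzd
    by_contra hcon
    push Not at hcon
    nlinarith [hmb t]

end IsC1JordanParam

/-! ### Tools: Cauchy-type integrals and connected components. -/

/-- A Cauchy-type integral may be differentiated under the integral sign off the curve. -/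
lemma hasDerivAt_integral_div_sub {γ g : ℝ → ℂ} (hγ : Continuous γ) (hg : Continuous g)
    (hcl : IsClosed (range γ)) {z₀ : ℂ} (hz₀ : z₀ ∉ range γ) :
    HasDerivAt (fun z => ∫ t in (0 : ℝ)..1, g t / (γ t - z))
      (∫ t in (0 : ℝ)..1, g t / (γ t - z₀) ^ 2) z₀ := by
  obtain ⟨δ, hδ, hball⟩ := Metric.isOpen_iff.1 hcl.isOpen_compl z₀ hz₀
  have hdist : ∀ t, ∀ z ∈ ball z₀ (δ / 2), δ / 2 ≤ ‖γ t - z‖ := fun t z hz => by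
    have h1 : δ ≤ dist (γ t) z₀ := by
      by_contra hcon
      exact hball (mem_ball.2 (not_le.1 hcon)) (mem_range_self t)
    have h2 := dist_triangle (γ t) z z₀
    rw [mem_ball] at hz
    rw [← dist_eq_norm]
    linarith
  have hne : ∀ t, ∀ z ∈ ball z₀ (δ / 2), γ t - z ≠ 0 := fun t z hz =>
    norm_pos_iff.1 ((half_pos hδ).trans_le (hdist t z hz))
  have hmem : z₀ ∈ ball z₀ (δ / 2) := mem_ball_self (half_pos hδ)
  have hcont : ∀ z ∈ ball z₀ (δ / 2), Continuous fun t => g t / (γ t - z) := fun z hz =>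
    hg.div (hγ.sub continuous_const) fun t => hne t z hz
  have hcont' : Continuous fun t => g t / (γ t - z₀) ^ 2 :=
    hg.div ((hγ.sub continuous_const).pow 2) fun t => pow_ne_zero 2 (hne t z₀ hmem)
  refine (intervalIntegral.hasDerivAt_integral_of_dominated_loc_of_deriv_le
    (F' := fun z t => g t / (γ t - z) ^ 2) (bound := fun t => ‖g t‖ / (δ / 2) ^ 2)
    (ball_mem_nhds z₀ (half_pos hδ)) ?_ ((hcont z₀ hmem).intervalIntegrable _ _)
    hcont'.aestronglyMeasurable ?_ ((hg.norm.div_const _).intervalIntegrable _ _) ?_).2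
  · filter_upwards [ball_mem_nhds z₀ (half_pos hδ)] with z hz
    exact (hcont z hz).aestronglyMeasurable
  · refine Eventually.of_forall fun t _ z hz => ?_
    rw [norm_div, norm_pow]
    have := hdist t z hz
    gcongr
  · refine Eventually.of_forall fun t _ z hz => ?_
    have h1 := (hasDerivAt_const z (g t)).div ((hasDerivAt_id z).const_sub (γ t)) (hne t z hz)
    exact h1.congr_deriv (by simp)

lemma windingNumber_eq (γ : ℝ → ℂ) (z : ℂ) :
    windingNumber γ z
      = 1 / (2 * Real.pi * I) * ∫ t in (0 : ℝ)..1, deriv γ t / (γ t - z) := by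
  simp only [windingNumber, contourIntegral, one_div_mul_eq_div]

/-- A connected set which meets `D` but not its boundary is contained in `D`. -/
lemma IsPreconnected.subset_of_disjoint_frontier {X : Type*} [TopologicalSpace X] {C D : Set X}
    (hC : IsPreconnected C) (hD : IsOpen D) (hdisj : Disjoint C (frontier D))
    (hne : (C ∩ D).Nonempty) : C ⊆ D := by
  refine hC.subset_left_of_subset_union hD isClosed_closure.isOpen_compl
    (disjoint_compl_right.mono_left subset_closure) (fun x hx => ?_) hne
  by_cases hxD : x ∈ D
  · exact Or.inl hxD
  · refine Or.inr fun hcl => disjoint_left.1 hdisj hx ?_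
    rw [hD.frontier_eq]
    exact ⟨hcl, hxD⟩

/-- The boundary of a connected component of an open set lies outside that open set. -/
lemma frontier_connectedComponentIn_subset {X : Type*} [TopologicalSpace X]
    [LocallyConnectedSpace X] {U : Set X} (hU : IsOpen U) (x : X) :
    frontier (connectedComponentIn U x) ⊆ Uᶜ := by
  intro y hy hyU
  have hy' := hy
  rw [hU.connectedComponentIn.frontier_eq] at hy
  -- The component of `y` is an open neighbourhood of `y`, so it meets the component of `x` and
  -- coincides with it.
  obtain ⟨w, hw1, hw2⟩ := mem_closure_iff.1 hy.1 _ (hU.connectedComponentIn (x := y))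
    (mem_connectedComponentIn hyU)
  have := connectedComponentIn_eq hw1
  rw [connectedComponentIn_eq hw2, ← this] at hy
  exact hy.2 (mem_connectedComponentIn hyU)

/-! ### Winding numbers and collars. -/

namespace IsC1JordanParam

variable {γ : ℝ → ℂ}

/-- The differentiated integrand has the primitive -1/(γ - z), which takes equal values at both ends
of a period. -/
lemma hasDerivAt_windingNumber (h : IsC1JordanParam γ) {z : ℂ} (hz : z ∉ range γ) :
    HasDerivAt (windingNumber γ) 0 z := by
  have hγ := h.contDiff.continuous
  have hne : ∀ t, γ t - z ≠ 0 := fun t h0 => hz ⟨t, sub_eq_zero.1 h0⟩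
  have hint : ∫ t in (0 : ℝ)..1, deriv γ t / (γ t - z) ^ 2 = 0 := by
    have hd : ∀ t ∈ uIcc (0 : ℝ) 1,
        HasDerivAt (fun t => -(γ t - z)⁻¹) (deriv γ t / (γ t - z) ^ 2) t := fun t _ =>
      (((h.hasDerivAt t).sub_const z).inv (hne t)).neg.congr_deriv (by ring)
    rw [intervalIntegral.integral_eq_sub_of_hasDerivAt hd
      (Continuous.intervalIntegrable (h.continuous_deriv.div ((hγ.sub continuous_const).pow 2)
        fun t => pow_ne_zero 2 (hne t)) _ _)]
    have := h.periodic 0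
    rw [zero_add] at this
    rw [this, sub_self]
  have := (hasDerivAt_integral_div_sub hγ h.continuous_deriv h.isCompact_range.isClosed hz).const_mul
    (1 / (2 * Real.pi * I) : ℂ)
  rw [hint, mul_zero] at this
  rwa [funext (windingNumber_eq γ)]

lemma windingNumber_eq_of_isPreconnected (h : IsC1JordanParam γ) {C : Set ℂ}
    (hC : IsPreconnected C) (hCγ : C ⊆ (range γ)ᶜ) {z w : ℂ} (hz : z ∈ C) (hw : w ∈ C) :
    windingNumber γ z = windingNumber γ w := by
  have hV : IsOpen (connectedComponentIn (range γ)ᶜ z) :=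
    h.isCompact_range.isClosed.isOpen_compl.connectedComponentIn
  have hd : ∀ x ∈ connectedComponentIn (range γ)ᶜ z, HasDerivAt (windingNumber γ) 0 x :=
    fun x hx => h.hasDerivAt_windingNumber (connectedComponentIn_subset _ _ hx)
  exact hV.is_const_of_deriv_eq_zero isPreconnected_connectedComponentIn
    (fun x hx => (hd x hx).differentiableAt.differentiableWithinAt)
    (fun x hx => (hd x hx).deriv) (mem_connectedComponentIn (hCγ hz))
    (hC.subset_connectedComponentIn hz hCγ hw)

/-- On a real ray beyond the curve the winding number is constant, yet bounded by a quantity tending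
to 0 at infinity. -/
lemma exists_windingNumber_eq_zero (h : IsC1JordanParam γ) :
    ∃ z ∉ range γ, windingNumber γ z = 0 := by
  obtain ⟨R, hR, hRb⟩ := h.isCompact_range.isBounded.exists_pos_norm_le
  obtain ⟨M, hM, hMb⟩ := h.exists_norm_deriv_le
  set C : Set ℂ := (fun r : ℝ => (r : ℂ)) '' Ioi R with hCdef
  have hC : IsPreconnected C :=
    isPreconnected_Ioi.image _ continuous_ofReal.continuousOn
  have hCγ : C ⊆ (range γ)ᶜ := by
    rintro _ ⟨r, hr, rfl⟩ hmem
    have := hRb _ hmem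
    rw [norm_real, Real.norm_eq_abs] at this
    exact absurd (le_trans (le_abs_self r) this) (not_le.2 hr)
  have hmem : ∀ n : ℝ, 0 < n → ((R + n : ℝ) : ℂ) ∈ C := fun n hn =>
    ⟨R + n, by simpa using hn, rfl⟩
  refine ⟨((R + 1 : ℝ) : ℂ), hCγ (hmem 1 one_pos), ?_⟩
  have hbound : ∀ n : ℝ, 0 < n →
      ‖windingNumber γ ((R + 1 : ℝ) : ℂ)‖ ≤ ‖(1 / (2 * Real.pi * I) : ℂ)‖ * (M / n) := by
    intro n hn
    rw [h.windingNumber_eq_of_isPreconnected hC hCγ (hmem 1 one_pos) (hmem n hn),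
      windingNumber_eq, norm_mul]
    gcongr
    refine (intervalIntegral.norm_integral_le_of_norm_le_const (C := M / n) fun t _ => ?_).trans
      (by simp)
    have h1 : n ≤ ‖γ t - ((R + n : ℝ) : ℂ)‖ := by
      have h2 := norm_sub_norm_le ((R + n : ℝ) : ℂ) (γ t)
      rw [norm_sub_rev, norm_real, Real.norm_eq_abs, abs_of_pos (by linarith)] at h2
      linarith [hRb _ (mem_range_self t)]
    rw [norm_div]
    have := hMb t
    gcongr
  have hlim : Tendsto (fun n : ℝ => ‖(1 / (2 * Real.pi * I) : ℂ)‖ * (M / n)) atTop (𝓝 0) := by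
    simpa using (tendsto_const_nhds.div_atTop tendsto_id).const_mul
      ‖(1 / (2 * Real.pi * I) : ℂ)‖
  have := ge_of_tendsto hlim (by
    filter_upwards [eventually_gt_atTop 0] with n hn using hbound n hn)
  exact norm_le_zero_iff.1 this

/-- The two one-sided collars of the curve: connected sets off the curve, accumulating at each of
its points, one of which meets each nonempty proper set whose boundary lies on the curve. -/
lemma exists_collars (h : IsC1JordanParam γ) :
    ∃ A B : Set ℂ, IsPreconnected A ∧ IsPreconnected B ∧ A ⊆ (range γ)ᶜ ∧ B ⊆ (range γ)ᶜ ∧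
      range γ ⊆ closure A ∧ range γ ⊆ closure B ∧
      ∀ V : Set ℂ, V ⊆ (range γ)ᶜ → V.Nonempty → frontier V ⊆ range γ →
        (V ∩ A).Nonempty ∨ (V ∩ B).Nonempty := by
  obtain ⟨ε₀, hε₀, hcol⟩ := h.exists_normal_notMem_range
  obtain ⟨δ, hδ, hnear⟩ := h.exists_eq_normal hε₀
  let F : ℝ × ℝ → ℂ := fun p => γ p.1 + p.2 * (I * deriv γ p.1)
  have hγ := h.contDiff.continuous
  have hγ' := h.continuous_deriv
  have hF : Continuous F := by fun_prop
  have hcl : ∀ S : Set ℝ, (0 : ℝ) ∈ closure S → range γ ⊆ closure (F '' (univ ×ˢ S)) := by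
    rintro S hS _ ⟨t, rfl⟩
    have : F (t, 0) ∈ closure (F '' (univ ×ˢ S)) :=
      image_closure_subset_closure_image hF ⟨(t, 0), by simpa [closure_prod_eq] using hS, rfl⟩
    simpa [F] using this
  refine ⟨F '' (univ ×ˢ Ioo 0 ε₀), F '' (univ ×ˢ Ioo (-ε₀) 0),
    (isPreconnected_univ.prod isPreconnected_Ioo).image _ hF.continuousOn,
    (isPreconnected_univ.prod isPreconnected_Ioo).image _ hF.continuousOn, ?_, ?_, hcl _ ?_,
    hcl _ ?_, fun V hV hne hfr => ?_⟩
  · rintro _ ⟨⟨t, ε⟩, ⟨-, h1, h2⟩, rfl⟩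
    exact hcol t ε h1.ne' (by rwa [abs_of_pos h1])
  · rintro _ ⟨⟨t, ε⟩, ⟨-, h1, h2⟩, rfl⟩
    exact hcol t ε h2.ne (by rw [abs_of_neg h2]; linarith)
  · rw [closure_Ioo hε₀.ne]
    exact ⟨le_rfl, hε₀.le⟩
  · rw [closure_Ioo (by linarith)]
    exact ⟨by linarith, le_rfl⟩
  -- `V` has a frontier point on the curve, hence points so near the curve that they lie on short
  -- normal segments.
  · have hVu : V ≠ univ := fun hu => hV (hu ▸ mem_univ (γ 0)) (mem_range_self 0)
    obtain ⟨p, hp⟩ := nonempty_frontier_iff.2 ⟨hne, hVu⟩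
    obtain ⟨z, hzV, hzp⟩ := Metric.mem_closure_iff.1 (frontier_subset_closure hp) δ hδ
    obtain ⟨t, ε, hε, hεε, rfl⟩ := hnear z (hV hzV)
      ((infDist_le_dist_of_mem (hfr hp)).trans_lt (by rwa [dist_comm]))
    rw [abs_lt] at hεε
    rcases hε.lt_or_gt with h0 | h0
    · exact Or.inr ⟨_, hzV, (t, ε), ⟨mem_univ _, hεε.1, h0⟩, rfl⟩
    · exact Or.inl ⟨_, hzV, (t, ε), ⟨mem_univ _, h0, hεε.2⟩, rfl⟩

end IsC1JordanParam

/-! ### The exterior of the domain. -/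

namespace IsPositiveC1Param

variable {γ : ℝ → ℂ} {Γ D : Set ℂ}

/-- Off the closed domain the winding number vanishes, and the boundary curve is also the boundary
of that exterior. -/
lemma windingNumber_eq_zero_and_subset_closure (hD : IsEnclosedBy D Γ)
    (hγ : IsPositiveC1Param γ Γ D) :
    (∀ z ∉ closure D, windingNumber γ z = 0) ∧ Γ ⊆ closure (closure D)ᶜ := by
  have h := hγ.isC1JordanParam
  have hfr : frontier D = range γ := hD.frontier_eq.trans hγ.range_eq.symm
  have hDγ : D ⊆ (range γ)ᶜ := by
    rw [← hfr]
    exact (disjoint_frontier_iff_isOpen.2 hD.isOpen).symm.subset_compl_right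
  have hopen : IsOpen (range γ)ᶜ := h.isCompact_range.isClosed.isOpen_compl
  have hsub : ∀ C : Set ℂ, IsPreconnected C → C ⊆ (range γ)ᶜ → (C ∩ D).Nonempty → C ⊆ D :=
    fun C hC hCγ hne => hC.subset_of_disjoint_frontier hD.isOpen
      (by rw [hfr]; exact subset_compl_iff_disjoint_right.1 hCγ) hne
  -- Stated for an arbitrary pair so that `A` can be whichever collar meets `D`.
  have key : ∀ A B : Set ℂ, IsPreconnected A → IsPreconnected B → A ⊆ (range γ)ᶜ →
      B ⊆ (range γ)ᶜ → range γ ⊆ closure B →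
      (∀ V : Set ℂ, V ⊆ (range γ)ᶜ → V.Nonempty → frontier V ⊆ range γ →
        (V ∩ A).Nonempty ∨ (V ∩ B).Nonempty) → (D ∩ A).Nonempty →
      (∀ z ∉ closure D, windingNumber γ z = 0) ∧ Γ ⊆ closure (closure D)ᶜ := by
    rintro A B hA hB hAγ hBγ hBcl hV ⟨x, hxD, hxA⟩
    have hAD : A ⊆ D := hsub A hA hAγ ⟨x, hxA, hxD⟩
    -- The component of `z` meets a collar. It cannot be `A`, which lies in `D`, since the component
    -- would then lie in `D` too.
    have hcomp : ∀ z ∉ range γ, z ∉ D → ∃ w ∈ B, windingNumber γ w = windingNumber γ z := by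
      intro z hz hzD
      have hzV := mem_connectedComponentIn (F := (range γ)ᶜ) hz
      have hpre := isPreconnected_connectedComponentIn (F := (range γ)ᶜ) (x := z)
      have hVs := connectedComponentIn_subset (range γ)ᶜ z
      rcases hV _ hVs ⟨z, hzV⟩
        ((frontier_connectedComponentIn_subset hopen z).trans (compl_compl _).subset) with
        ⟨w, hw, hwA⟩ | ⟨w, hw, hwB⟩
      · exact absurd (hsub _ hpre hVs ⟨w, hw, hAD hwA⟩ hzV) hzD
      · exact ⟨w, hwB, h.windingNumber_eq_of_isPreconnected hpre hVs hw hzV⟩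
    obtain ⟨z₀, hz₀, hwz₀⟩ := h.exists_windingNumber_eq_zero
    obtain ⟨w₀, hw₀, hww₀⟩ := hcomp z₀ hz₀ fun hz₀D => by
      rw [hγ.winding z₀ hz₀D] at hwz₀
      exact one_ne_zero hwz₀
    have hB0 : ∀ w ∈ B, windingNumber γ w = 0 := fun w hw => by
      rw [h.windingNumber_eq_of_isPreconnected hB hBγ hw hw₀, hww₀, hwz₀]
    have hclD : closure D = D ∪ range γ := by rw [closure_eq_self_union_frontier, hfr]
    refine ⟨fun z hz => ?_, ?_⟩
    · rw [hclD, mem_union, not_or] at hz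
      obtain ⟨w, hw, hwz⟩ := hcomp z hz.2 hz.1
      rw [← hwz, hB0 w hw]
    · rw [← hγ.range_eq]
      refine hBcl.trans (closure_mono fun w hw hwD => ?_)
      rw [hclD] at hwD
      rcases hwD with hwD | hwγ
      · have := hγ.winding w hwD
        rw [hB0 w hw] at this
        exact zero_ne_one this
      · exact hBγ hw hwγ
  obtain ⟨A, B, hA, hB, hAγ, hBγ, hAcl, hBcl, hV⟩ := h.exists_collars
  rcases hV D hDγ hD.isConnected.nonempty hfr.subset with hDA | hDB
  · exact key A B hA hB hAγ hBγ hBcl hV hDA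
  · exact key B A hB hA hBγ hAγ hAcl (fun V h1 h2 h3 => (hV V h1 h2 h3).symm) hDB

end IsPositiveC1Param

/-! ### The regularized Cauchy integral. -/

/-- The Cauchy integral of `ξ ↦ conj ξ - conj z` along `γ`, evaluated at `z`. Its kernel is bounded,
so it is defined and continuous on the whole plane. -/
noncomputable def regularizedCauchyIntegralConj (γ : ℝ → ℂ) (z : ℂ) : ℂ :=
  1 / (2 * Real.pi * I) *
    ∫ t in (0 : ℝ)..1, (starRingEnd ℂ) (γ t - z) / (γ t - z) * deriv γ t

namespace IsC1JordanParam

variable {γ : ℝ → ℂ}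

lemma continuous_regularizedCauchyIntegralConj (h : IsC1JordanParam γ) :
    Continuous (regularizedCauchyIntegralConj γ) := by
  have hγ := h.contDiff.continuous
  have hγ' := h.continuous_deriv
  refine continuous_const.mul (continuous_iff_continuousAt.2 fun z₀ => ?_)
  refine intervalIntegral.continuousAt_of_dominated_interval (bound := fun t => ‖deriv γ t‖)
    (Eventually.of_forall fun z => ?_) (Eventually.of_forall fun z => ?_)
    (hγ'.norm.intervalIntegrable _ _) ?_
  · have h1 : Measurable fun t => (starRingEnd ℂ) (γ t - z) :=
      (continuous_conj.comp (hγ.sub continuous_const)).measurable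
    have h2 : Measurable fun t => γ t - z := (hγ.sub continuous_const).measurable
    exact ((h1.div h2).mul hγ'.measurable).aestronglyMeasurable
  · refine Eventually.of_forall fun t _ => ?_
    rw [norm_mul, norm_div, RCLike.norm_conj]
    -- The quotient has modulus 1, or 0 where γ(t) = z by the convention 0/0 = 0.
    exact mul_le_of_le_one_left (norm_nonneg _) (div_self_le_one _)
  -- The kernel can be discontinuous at `z₀` only for parameters in one class modulo 1, a null set.
  · have hcount : {t | γ t = z₀}.Countable := by
      rcases Set.eq_empty_or_nonempty {t | γ t = z₀} with he | ⟨s, hs⟩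
      · rw [he]
        exact countable_empty
      · refine (countable_range fun n : ℤ => s + n).mono fun t ht => ?_
        obtain ⟨n, hn⟩ := h.exists_int_of_eq (Eq.trans ht (Eq.symm hs))
        exact ⟨n, by simp only; linarith⟩
    filter_upwards [hcount.ae_notMem MeasureTheory.volume] with t ht _
    have hne : γ t - z₀ ≠ 0 := sub_ne_zero.2 ht
    have h1 : ContinuousAt (fun z => γ t - z) z₀ := by fun_prop
    exact ((continuous_conj.continuousAt.comp h1).div h1 hne).mul continuousAt_const

lemma regularizedCauchyIntegralConj_eq (h : IsC1JordanParam γ) {z : ℂ} (hz : z ∉ range γ) :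
    regularizedCauchyIntegralConj γ z
      = cauchyIntegralConj γ z - (starRingEnd ℂ) z * windingNumber γ z := by
  have hγ := h.contDiff.continuous
  have hγ' := h.continuous_deriv
  have hne : ∀ t, γ t - z ≠ 0 := fun t h0 => hz ⟨t, sub_eq_zero.1 h0⟩
  have hi : Continuous fun t => (γ t - z)⁻¹ := (hγ.sub continuous_const).inv₀ hne
  have hint : ∀ g : ℝ → ℂ, Continuous g → IntervalIntegrable (fun t => g t / (γ t - z) * deriv γ t)
      MeasureTheory.volume 0 1 := fun g hg =>
    ((hg.mul hi).mul hγ').intervalIntegrable _ _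
  have hsub := intervalIntegral.integral_sub (hint _ (continuous_conj.comp hγ))
    ((hint (fun _ => 1) continuous_const).const_mul ((starRingEnd ℂ) z))
  rw [intervalIntegral.integral_const_mul] at hsub
  simp only [regularizedCauchyIntegralConj, cauchyIntegralConj, windingNumber, contourIntegral]
  rw [mul_left_comm, ← mul_sub]
  refine congrArg _ (Eq.trans ?_ hsub)
  refine intervalIntegral.integral_congr fun t _ => ?_
  simp only [map_sub, Function.comp]
  ring

lemma differentiableAt_cauchyIntegralConj (h : IsC1JordanParam γ) {z : ℂ} (hz : z ∉ range γ) :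
    DifferentiableAt ℂ (cauchyIntegralConj γ) z := by
  have hγ := h.contDiff.continuous
  have := (hasDerivAt_integral_div_sub hγ ((continuous_conj.comp hγ).mul h.continuous_deriv)
    h.isCompact_range.isClosed hz).const_mul (1 / (2 * Real.pi * I) : ℂ)
  refine this.differentiableAt.congr_of_eventuallyEq (Eventually.of_forall fun w => ?_)
  simp only [cauchyIntegralConj, contourIntegral, div_mul_eq_mul_div (_ : ℂ) _ (deriv _ _),
    Pi.mul_apply, Function.comp]

end IsC1JordanParam

/-! ### Real boundary values and the conclusion. -/

/-- A holomorphic function on a bounded domain, continuous up to the boundary and real on it, is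
constant on the closed domain. -/
lemma exists_eq_of_im_eq_zero_on_frontier {D : Set ℂ} (hDo : IsOpen D) (hDc : IsConnected D)
    (hDb : Bornology.IsBounded D) {G : ℂ → ℂ} (hG : DiffContOnCl ℂ G D)
    (him : ∀ z ∈ frontier D, (G z).im = 0) :
    ∃ c : ℂ, ∀ z ∈ closure D, G z = c := by
  -- For s = ±i, exp(sG) has modulus 1 on the frontier; the maximum principle for both signs bounds
  -- Im G from both sides by 0.
  have key : ∀ s : ℂ, s.re = 0 → ∀ z ∈ closure D, ‖exp (s * G z)‖ ≤ 1 := by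
    intro s hs z hz
    have hd : DiffContOnCl ℂ (fun z => exp (s * G z)) D :=
      differentiable_exp.comp_diffContOnCl (hG.const_smul s)
    refine norm_le_of_forall_mem_frontier_norm_le hDb hd (fun w hw => ?_) hz
    rw [norm_exp, mul_re, hs, him w hw]
    simp
  have him' : ∀ z ∈ D, (G z).im = 0 := by
    intro z hz
    have h1 := key I (by simp) z (subset_closure hz)
    have h2 := key (-I) (by simp) z (subset_closure hz)
    rw [norm_exp, Real.exp_le_one_iff] at h1 h2
    simp at h1 h2
    exact le_antisymm h2 h1
  obtain ⟨c, hc⟩ := (hG.differentiableOn.analyticOnNhd hDo).eq_const_of_im_eq_const him' hDo hDc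
  have : EqOn G (fun _ => c) (closure D) :=
    EqOn.of_subset_closure (fun z hz => hc z hz) hG.continuousOn continuousOn_const subset_closure
      subset_rfl
  exact ⟨c, this⟩

theorem mainTheorem4 (Γ D : Set ℂ) (hD : IsEnclosedBy D Γ)
    (γ : ℝ → ℂ) (hγ : IsPositiveC1Param γ Γ D)
    (z₁ : ℂ) (hz₁ : z₁ ∈ D) (a b : ℝ)
    (hcauchy : ∀ z : ℂ, z ∉ closure D →
      cauchyIntegralConj γ z = (a : ℂ) / (z - z₁) + (b : ℂ) / (z - z₁) ^ 2) :
    ∃ c : ℝ, Γ ⊆ {z : ℂ | ‖z - z₁‖ ^ 4 + a * ‖z - z₁‖ ^ 2 + 2 * b * z.re = c} := by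
  have h := hγ.isC1JordanParam
  obtain ⟨hw0, hΓcl⟩ := hγ.windingNumber_eq_zero_and_subset_closure hD
  have hΓfr : Γ ⊆ closure D := hD.frontier_eq ▸ frontier_subset_closure
  have hΓD : Disjoint Γ D := hD.frontier_eq ▸ disjoint_frontier_iff_isOpen.2 hD.isOpen
  set Ψ := regularizedCauchyIntegralConj γ with hΨdef
  have hΨc : Continuous Ψ := h.continuous_regularizedCauchyIntegralConj
  have hΨD : ∀ z ∈ D, Ψ z = cauchyIntegralConj γ z - (starRingEnd ℂ) z := fun z hz => by
    rw [hΨdef, h.regularizedCauchyIntegralConj_eq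
      (by rw [hγ.range_eq]; exact disjoint_right.1 hΓD hz), hγ.winding z hz, mul_one]
  have hΨext : ∀ z ∉ closure D, Ψ z = a / (z - z₁) + b / (z - z₁) ^ 2 := fun z hz => by
    rw [hΨdef, h.regularizedCauchyIntegralConj_eq
      (by rw [hγ.range_eq]; exact fun hzΓ => hz (hΓfr hzΓ)), hw0 z hz, mul_zero, sub_zero,
      hcauchy z hz]
  have hneΓ : ∀ z ∈ Γ, z - z₁ ≠ 0 := fun z hz h0 =>
    disjoint_left.1 hΓD hz (sub_eq_zero.1 h0 ▸ hz₁)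
  have hΨΓ : ∀ z ∈ Γ, Ψ z = a / (z - z₁) + b / (z - z₁) ^ 2 := fun p hp => by
    have := mem_closure_iff_nhdsWithin_neBot.1 (hΓcl hp)
    have h1 : Tendsto Ψ (𝓝[(closure D)ᶜ] p) (𝓝 (Ψ p)) := hΨc.continuousAt.tendsto.mono_left
      nhdsWithin_le_nhds
    have h2 : ContinuousAt (fun z => (a : ℂ) / (z - z₁) + b / (z - z₁) ^ 2) p := by
      have hs : ContinuousAt (fun z => z - z₁) p := by fun_prop
      exact (continuousAt_const.div hs (hneΓ p hp)).add
        (continuousAt_const.div (hs.pow 2) (pow_ne_zero 2 (hneΓ p hp)))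
    refine tendsto_nhds_unique h1 ((h2.tendsto.mono_left nhdsWithin_le_nhds).congr' ?_)
    filter_upwards [self_mem_nhdsWithin] with z hz using (hΨext z hz).symm
  -- `H` continues the holomorphic part of the Schwarz function of `Γ` to the closed domain.
  set H : ℂ → ℂ := fun z => Ψ z + (starRingEnd ℂ) (z - z₁) with hHdef
  have hHc : Continuous H := hΨc.add (continuous_conj.comp (continuous_id.sub continuous_const))
  have hHd : DifferentiableOn ℂ H D := by
    have : DifferentiableOn ℂ (fun z => cauchyIntegralConj γ z - (starRingEnd ℂ) z₁) D :=
      fun z hz => ((h.differentiableAt_cauchyIntegralConj (by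
        rw [hγ.range_eq]; exact disjoint_right.1 hΓD hz)).sub_const _).differentiableWithinAt
    refine this.congr fun z hz => ?_
    rw [hHdef]
    simp only
    rw [hΨD z hz, map_sub]
    ring
  -- On Γ, wH - a = |w|² + b/w. Its square has the polar part b²/w², which -bH cancels while adding
  -- -ab/w, and a(wH - a) cancels the latter. What remains is |w|⁴ + a|w|² + b conj w, and bw makes
  -- it real.
  set G : ℂ → ℂ := fun z => ((z - z₁) * H z - a) ^ 2 - b * H z + a * ((z - z₁) * H z - a)
    + b * (z - z₁) with hGdef
  have hGΓ : ∀ z ∈ Γ, G z = ((‖z - z₁‖ ^ 4 + a * ‖z - z₁‖ ^ 2 + 2 * b * (z - z₁).re : ℝ) : ℂ) := by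
    intro z hz
    have hne := hneΓ z hz
    have hre : ((z - z₁) + (starRingEnd ℂ) (z - z₁) : ℂ) = ((2 * (z - z₁).re : ℝ) : ℂ) :=
      add_conj _
    have hn : ((‖z - z₁‖ : ℂ)) ^ 2 = (z - z₁) * (starRingEnd ℂ) (z - z₁) := (mul_conj' _).symm
    have e1 : ((‖z - z₁‖ ^ 4 + a * ‖z - z₁‖ ^ 2 + 2 * b * (z - z₁).re : ℝ) : ℂ)
        = ((‖z - z₁‖ : ℂ) ^ 2) ^ 2 + a * (‖z - z₁‖ : ℂ) ^ 2 + b * ((2 * (z - z₁).re : ℝ) : ℂ) := by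
      push_cast
      ring
    rw [e1, hn, ← hre]
    simp only [hGdef, hHdef, hΨΓ z hz]
    generalize (starRingEnd ℂ) (z - z₁) = v
    generalize z - z₁ = w at hne
    field_simp
    ring
  have hGdc : DiffContOnCl ℂ G D := by
    refine ⟨?_, ?_⟩
    · fun_prop
    · exact Continuous.continuousOn (by fun_prop)
  obtain ⟨c, hc⟩ := exists_eq_of_im_eq_zero_on_frontier hD.isOpen hD.isConnected hD.isBounded
    hGdc (fun z hz => by rw [hGΓ z (hD.frontier_eq ▸ hz), ofReal_im])
  -- The shift 2b Re z₁ converts Re(z - z₁) into Re z.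
  refine ⟨c.re + 2 * b * z₁.re, fun z hz => ?_⟩
  have h1 := congrArg re ((hGΓ z hz).symm.trans (hc z (hΓfr hz)))
  rw [ofReal_re, sub_re] at h1
  rw [mem_ofPred_eq]
  linarith
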